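/- Let $f:\mathbb{R}\to\mathbb{R}$ be locally Lipschitz continuous with $f(0)=0$ and $uf(u)>0$ for all $u\neq 0$. For $u>0$ put $F(u)=\int_u^1 \frac{dv}{f(v)}$, and suppose that $F(u)\to+\infty$ as $u\to 0^+$; then $F$ is strictly decreasing on $(0,\infty)$, and its inverse $F^{-1}$ is defined at least on $[0,\infty)$. Let $g:[0,\infty)\to\mathbb{R}$ be continuous with $g(t)>0$ for $t>0$, let $\xi>0$, and let $x:[0,\infty)\to\mathbb{R}$ be the (unique) continuous solution of $$x'(t)=-f(x(t))+g(t),\quad t>0;\qquad x(0)=\xi.$$ Suppose that there are $\delta>0$ and a function $\phi$ that is increasing (not necessarily strictly) on $(0,\delta)$ such that $\lim_{u\to0^+}f(u)/\phi(u)=1$, and that there is $L\in(0,\infty)$ with $$\lim_{t\to\infty}\frac{g(t)}{f(F^{-1}(t))}=L.$$ A measurable function $h$, positive on $(0,\infty)$, is in $\mathrm{RV}_0(\beta)$ if $\lim_{u\to0^+}h(cu)/h(u)=c^{\beta}$ for all $c>0$; a measurable function $h$, positive on $[0,\infty)$, is in $\mathrm{RV}_\infty(\alpha)$ if $\lim_{t\to\infty}h(ct)/h(t)=c^{\alpha}$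 for all $c>0$. Then $x(t)\to0$ as $t\to\infty$. Moreover: (i) If $f\in\mathrm{RV}_0(\beta)$ for some $\beta>1$, then the equation $(1-\Lambda)\Lambda^{-\beta/(\beta-1)}=L$ has exactly one solution $\Lambda_*$ in $(0,\infty)$; it lies in $(0,1)$, and $$\lim_{t\to\infty}\frac{F(x(t))}{t}=\Lambda_*.$$ (ii) If $f\circ F^{-1}\in\mathrm{RV}_\infty(-1)$ and $F^{-1}\in\mathrm{RV}_\infty(0)$, then the equation $(1-\Lambda)\Lambda^{-1}=L$ has exactly one solution $\Lambda_*$ in $(0,\infty)$, namely $\Lambda_*=\frac{1}{1+L}\in(0,1)$, and $$\lim_{t\to\infty}\frac{F(x(t))}{t}=\Lambda_*.$$ -/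

import Mathlib

open Set Filter Topology MeasureTheory

namespace PerturbedODE

/-- `F(x) = ∫_x^1 du / f(u)`, of interest for `x > 0`. -/
noncomputable def F (f : ℝ → ℝ) (x : ℝ) : ℝ :=
  ∫ u in x..1, 1 / f u

/-- The inverse of `F : (0, ∞) → ℝ`. (When `f > 0` on `(0, ∞)`, `F` is strictly decreasing there, and
when moreover `F(x) → ∞` as `x → 0+`, its range contains `[0, ∞)`.) -/
noncomputable def Finv (f : ℝ → ℝ) : ℝ → ℝ :=
  Function.invFunOn (F f) (Ioi 0)

/-- `f ∈ RV_0(β)`: the restriction of `f` to `(0, ∞)` is measurable, positive and regularly varying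
at `0` with index `β`. -/
def RVZero (f : ℝ → ℝ) (β : ℝ) : Prop :=
  Measurable (fun x : Ioi (0 : ℝ) => f x) ∧ (∀ x, 0 < x → 0 < f x) ∧
    ∀ c : ℝ, 0 < c → Tendsto (fun x => f (c * x) / f x) (𝓝[>] 0) (𝓝 (c ^ β))

/-- `h ∈ RV_∞(α)`: the restriction of `h` to `[0, ∞)` is measurable, positive and regularly varying
at infinity with index `α`. -/
def RVInfty (h : ℝ → ℝ) (α : ℝ) : Prop :=
  Measurable (fun t : Ici (0 : ℝ) => h t) ∧ (∀ t, 0 ≤ t → 0 < h t) ∧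
    ∀ c : ℝ, 0 < c → Tendsto (fun t => h (c * t) / h t) atTop (𝓝 (c ^ α))

/-- `x` is a continuous solution on `[0, ∞)` of `x'(t) = -f(x(t)) + g(t)`, `t > 0`, `x(0) = ξ`. -/
structure IsSolution (f g : ℝ → ℝ) (ξ : ℝ) (x : ℝ → ℝ) : Prop where
  continuousOn : ContinuousOn x (Ici 0)
  initial : x 0 = ξ
  hasDerivAt : ∀ t, 0 < t → HasDerivAt x (-f (x t) + g t) t

end PerturbedODE

namespace PerturbedODE

/-! Put `z = F(x(t))` and `a = f ∘ F⁻¹`. Since `F' = -1/f`, the equation becomes `z' = 1 -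
(g(t)/a(t)) · a(t)/a(z)`, with `g/a → L`. If `a` has index `-γ` at infinity and `z ~ Λt`, then
`a(t)/a(z) → Λ^γ`, so the rate must satisfy `Λ = 1 - LΛ^γ`.

A comparison with the lines `ct` makes this rigorous. Up to factors near one, `a` is decreasing,
because `f` is asymptotic to the increasing `φ`. So if `c < Λ` and `z ≤ ct`, then `z'` exceeds `c`
by a fixed margin, and `z` must overtake the line for good; the case `c > Λ` is symmetric. In (i) `γ
= β/(β-1)`, which requires transferring regular variation from `f` to `f ∘ F⁻¹`
(`tendsto_comp_Finv_div`); in (ii) `γ = 1` is given. -/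

/-- A differentiable function whose derivative is bounded above by a negative constant wherever it
is nonnegative is eventually nonpositive. -/
lemma eventually_nonpos_of_deriv_le {v v' : ℝ → ℝ} {T η : ℝ} (hη : 0 < η)
    (hv : ∀ t, T ≤ t → HasDerivAt v (v' t) t) (hneg : ∀ t, T ≤ t → 0 ≤ v t → v' t ≤ -η) :
    ∀ᶠ t in atTop, v t ≤ 0 := by
  have hex : ∃ t₁, T ≤ t₁ ∧ v t₁ ≤ 0 := by
    by_contra! hcon
    have hanti : AntitoneOn (fun t => v t + η * t) (Ici T) := by
      refine antitoneOn_of_hasDerivWithinAt_nonpos (f' := fun t => v' t + η) (convex_Ici T)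
        (fun t ht => ?_) (fun t ht => ?_) (fun t ht => ?_)
      · exact ((hv t ht).continuousAt.add (by fun_prop)).continuousWithinAt
      · rw [interior_Ici] at ht
        exact ((hv t (le_of_lt ht)).add (hasDerivAt_const_mul η)).hasDerivWithinAt
      · rw [interior_Ici] at ht
        have := hneg t (le_of_lt ht) (hcon t (le_of_lt ht)).le
        linarith
    have hT := hcon T le_rfl
    -- A line of slope `-η` starting at `v T` reaches zero at this time.
    have hs : T ≤ T + v T / η := by
      have : 0 ≤ v T / η := by positivity
      linarith
    have h1 := hanti (mem_Ici.2 le_rfl) (mem_Ici.2 hs) hs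
    have h2 := hcon _ hs
    have h3 : η * (T + v T / η) = η * T + v T := by field_simp
    simp only at h1
    linarith
  obtain ⟨t₁, hT, h₁⟩ := hex
  filter_upwards [eventually_ge_atTop t₁] with t ht
  refine image_le_of_deriv_right_lt_deriv_boundary' (f := v) (f' := v') (B := fun _ => 0)
    (B' := fun _ => 0) (a := t₁) (b := t) ?_ ?_ h₁ continuousOn_const
    (fun s _ => hasDerivWithinAt_const _ _ _) ?_ ⟨ht, le_rfl⟩
  · exact fun s hs => (hv s (hT.trans hs.1)).continuousAt.continuousWithinAt
  · exact fun s hs => (hv s (hT.trans hs.1)).hasDerivWithinAt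
  · intro s hs h0
    have := hneg s (hT.trans hs.1) h0.ge
    linarith

/-- Solutions of `z' = 1 - b(t) a(t) / a(z)`, where `b → L` and `a` is asymptotically decreasing and
regularly varying with index `-γ`, grow linearly at the rate `Λ` with `Λ + L Λ ^ γ = 1`. -/
lemma tendsto_div_of_hasDerivAt_of_regularlyVarying {a b z : ℝ → ℝ} {γ L Λ : ℝ} (hγ : 0 < γ)
    (hL : 0 < L) (hΛ : 0 < Λ) (hΛL : Λ + L * Λ ^ γ = 1)
    (ha_pos : ∀ᶠ t in atTop, 0 < a t)
    (ha_anti : ∀ ε > 0, ∃ T, ∀ s t, T ≤ s → s ≤ t → a t ≤ (1 + ε) * a s)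
    (ha : ∀ c, 0 < c → Tendsto (fun t => a (c * t) / a t) atTop (𝓝 (c ^ (-γ))))
    (hb : Tendsto b atTop (𝓝 L)) (hz_top : Tendsto z atTop atTop)
    (hz : ∀ t, 0 < t → HasDerivAt z (1 - b t * a t / a (z t)) t) :
    Tendsto (fun t => z t / t) atTop (𝓝 Λ) := by
  have hlim : ∀ c, 0 < c → Tendsto (fun t => b t / (a (c * t) / a t)) atTop (𝓝 (L * c ^ γ)) := by
    intro c hc
    have h := hb.div (ha c hc) (Real.rpow_pos_of_pos hc _).ne'
    rwa [Real.rpow_neg hc.le, div_inv_eq_mul] at h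
  have hb_pos : ∀ᶠ t in atTop, 0 < b t := hb.eventually (lt_mem_nhds hL)
  have hc_top : ∀ c : ℝ, 0 < c → Tendsto (fun t => c * t) atTop atTop := fun c hc =>
    tendsto_id.const_mul_atTop hc
  refine tendsto_order.2 ⟨fun l hl => ?_, fun l hl => ?_⟩
  · obtain ⟨c, hcl, hcΛ⟩ := exists_between (max_lt hl hΛ)
    have hc : 0 < c := (le_max_right _ _).trans_lt hcl
    -- Strict monotonicity of `c + L c ^ γ` leaves room both for the margin `η` in the slope and for
    -- the factor `1 + ε`.
    have hlt : L * c ^ γ < 1 - c := by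
      have := Real.rpow_lt_rpow hc.le hcΛ hγ
      nlinarith
    obtain ⟨η, hη, hη'⟩ : ∃ η > 0, L * c ^ γ < 1 - c - η :=
      ⟨(1 - c - L * c ^ γ) / 2, by linarith, by linarith⟩
    obtain ⟨ε, hε', hε⟩ : ∃ ε, (1 + ε) * (L * c ^ γ) < 1 - c - η ∧ 0 < ε := by
      have h : Tendsto (fun ε : ℝ => (1 + ε) * (L * c ^ γ)) (𝓝[>] 0) (𝓝 ((1 + 0) * (L * c ^ γ))) :=
        (Continuous.tendsto (by fun_prop) 0).mono_left nhdsWithin_le_nhds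
      exact ((h.eventually (gt_mem_nhds (by simpa using hη'))).and
        self_mem_nhdsWithin).exists
    obtain ⟨T₀, hT₀⟩ := ha_anti ε hε
    have key : ∀ᶠ t in atTop, 0 < t ∧ (z t ≤ c * t → c + η ≤ 1 - b t * a t / a (z t)) := by
      filter_upwards [((hlim c hc).const_mul (1 + ε)).eventually (gt_mem_nhds hε'), ha_pos,
        hz_top.eventually ha_pos, (hc_top c hc).eventually ha_pos, hb_pos,
        hz_top.eventually (eventually_ge_atTop T₀), eventually_gt_atTop 0]
        with t h1 h2 h3 h4 h5 h6 h7
      refine ⟨h7, fun hle => ?_⟩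
      have h8 := hT₀ _ _ h6 hle
      have h9 : b t * a t / a (z t) ≤ (1 + ε) * (b t / (a (c * t) / a t)) := by
        rw [div_div_eq_mul_div, ← mul_div_assoc, div_le_div_iff₀ h3 h4]
        nlinarith [mul_le_mul_of_nonneg_left h8 (mul_pos h5 h2).le]
      linarith
    obtain ⟨T, hT⟩ := eventually_atTop.1 key
    have := eventually_nonpos_of_deriv_le (v := fun t => c * t - z t)
      (v' := fun t => c - (1 - b t * a t / a (z t))) (T := T) hη
      (fun t ht => (hasDerivAt_const_mul c).sub (hz t (hT t ht).1))
      (fun t ht h0 => by have := (hT t ht).2 (by simpa using h0); linarith)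
    filter_upwards [this, eventually_gt_atTop 0] with t ht h0
    rw [lt_div_iff₀ h0]
    have : l * t < c * t := mul_lt_mul_of_pos_right ((le_max_left _ _).trans_lt hcl) h0
    linarith
  · obtain ⟨c, hcΛ, hcl⟩ := exists_between hl
    have hc : 0 < c := hΛ.trans hcΛ
    have hlt : 1 - c < L * c ^ γ := by
      have := Real.rpow_lt_rpow hΛ.le hcΛ hγ
      nlinarith
    obtain ⟨η, hη, hη'⟩ : ∃ η > 0, 1 - c + η < L * c ^ γ :=
      ⟨(L * c ^ γ - (1 - c)) / 2, by linarith, by linarith⟩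
    obtain ⟨ε, hε', hε⟩ : ∃ ε, (1 + ε) * (1 - c + η) < L * c ^ γ ∧ 0 < ε := by
      have h : Tendsto (fun ε : ℝ => (1 + ε) * (1 - c + η)) (𝓝[>] 0)
          (𝓝 ((1 + 0) * (1 - c + η))) :=
        (Continuous.tendsto (by fun_prop) 0).mono_left nhdsWithin_le_nhds
      exact ((h.eventually (gt_mem_nhds (by simpa using hη'))).and
        self_mem_nhdsWithin).exists
    obtain ⟨T₀, hT₀⟩ := ha_anti ε hε
    have key : ∀ᶠ t in atTop, 0 < t ∧ (c * t ≤ z t → 1 - b t * a t / a (z t) ≤ c - η) := by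
      filter_upwards [(hlim c hc).eventually (lt_mem_nhds hε'), ha_pos,
        hz_top.eventually ha_pos, (hc_top c hc).eventually ha_pos, hb_pos,
        (hc_top c hc).eventually (eventually_ge_atTop T₀), eventually_gt_atTop 0]
        with t h1 h2 h3 h4 h5 h6 h7
      refine ⟨h7, fun hle => ?_⟩
      have h8 := hT₀ _ _ h6 hle
      have h9 : b t / (a (c * t) / a t) ≤ (1 + ε) * (b t * a t / a (z t)) := by
        rw [div_div_eq_mul_div, ← mul_div_assoc, div_le_div_iff₀ h4 h3]
        nlinarith [mul_le_mul_of_nonneg_left h8 (mul_pos h5 h2).le]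
      have h10 : 1 - c + η < b t * a t / a (z t) :=
        lt_of_mul_lt_mul_left (h1.trans_le h9) (by linarith)
      linarith
    obtain ⟨T, hT⟩ := eventually_atTop.1 key
    have := eventually_nonpos_of_deriv_le (v := fun t => z t - c * t)
      (v' := fun t => (1 - b t * a t / a (z t)) - c) (T := T) hη
      (fun t ht => (hz t (hT t ht).1).sub (hasDerivAt_const_mul c))
      (fun t ht h0 => by have := (hT t ht).2 (by simpa using h0); linarith)
    filter_upwards [this, eventually_gt_atTop 0] with t ht h0
    rw [div_lt_iff₀ h0]
    have : c * t < l * t := mul_lt_mul_of_pos_right hcl h0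
    linarith

/-! ### L'Hôpital's rule and asymptotic monotonicity -/

/-- For `K < N < M`, the sign of `q'` makes `p - N q` increasing near `0`, hence bounded above
there; the term `(M - N) q → ∞` absorbs that bound. -/
lemma eventually_div_lt_of_hasDerivAt {p q p' q' : ℝ → ℝ} {K M : ℝ}
    (hp : ∀ u, 0 < u → HasDerivAt p (p' u) u) (hq : ∀ u, 0 < u → HasDerivAt q (q' u) u)
    (hq' : ∀ u, 0 < u → q' u < 0) (hq_top : Tendsto q (𝓝[>] 0) atTop)
    (h : Tendsto (fun u => p' u / q' u) (𝓝[>] 0) (𝓝 K)) (hM : K < M) :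
    ∀ᶠ u in 𝓝[>] 0, p u / q u < M := by
  obtain ⟨N, hKN, hNM⟩ := exists_between hM
  obtain ⟨r, hr, hrN⟩ := mem_nhdsGT_iff_exists_Ioo_subset.1 (h.eventually (gt_mem_nhds hKN))
  have hr : 0 < r := hr
  have hmono : MonotoneOn (fun u => p u - N * q u) (Ioo 0 r) := by
    refine monotoneOn_of_hasDerivWithinAt_nonneg (f' := fun u => p' u - N * q' u) (convex_Ioo 0 r)
      (fun u hu => ?_) (fun u hu => ?_) (fun u hu => ?_)
    · exact ((hp u hu.1).sub ((hq u hu.1).const_mul N)).continuousAt.continuousWithinAt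
    · rw [interior_Ioo] at hu
      exact ((hp u hu.1).sub ((hq u hu.1).const_mul N)).hasDerivWithinAt
    · rw [interior_Ioo] at hu
      have h1 : p' u / q' u < N := hrN hu
      rw [div_lt_iff_of_neg (hq' u hu.1)] at h1
      linarith
  have hr2 : r / 2 ∈ Ioo 0 r := ⟨by positivity, by linarith⟩
  filter_upwards [Ioo_mem_nhdsGT hr2.1, hq_top.eventually (eventually_gt_atTop 0),
    (hq_top.const_mul_atTop (sub_pos.2 hNM)).eventually
      (eventually_gt_atTop (p (r / 2) - N * q (r / 2)))] with u hu h0 h1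
  have h2 : p u - N * q u ≤ p (r / 2) - N * q (r / 2) :=
    hmono ⟨hu.1, hu.2.trans hr2.2⟩ hr2 hu.2.le
  rw [div_lt_iff₀ h0]
  linarith

/-- L'Hôpital's rule at `0+` for a denominator that tends to infinity. -/
lemma tendsto_div_of_hasDerivAt_of_tendsto_atTop {p q p' q' : ℝ → ℝ} {K : ℝ}
    (hp : ∀ u, 0 < u → HasDerivAt p (p' u) u) (hq : ∀ u, 0 < u → HasDerivAt q (q' u) u)
    (hq' : ∀ u, 0 < u → q' u < 0) (hq_top : Tendsto q (𝓝[>] 0) atTop)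
    (h : Tendsto (fun u => p' u / q' u) (𝓝[>] 0) (𝓝 K)) :
    Tendsto (fun u => p u / q u) (𝓝[>] 0) (𝓝 K) := by
  refine tendsto_order.2 ⟨fun M hM => ?_,
    fun M hM => eventually_div_lt_of_hasDerivAt hp hq hq' hq_top h hM⟩
  have := eventually_div_lt_of_hasDerivAt (fun u hu => (hp u hu).neg) hq hq' hq_top
    (by simpa only [neg_div] using h.neg) (neg_lt_neg hM)
  filter_upwards [this] with u hu
  simp only [Pi.neg_apply, neg_div] at hu
  linarith

/-- A function asymptotic at `0+` to a monotone one is monotone up to a factor close to one. -/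
lemma le_mul_of_tendsto_div_monotoneOn {f φ : ℝ → ℝ} {δ : ℝ} (hf : ∀ u, 0 < u → 0 < f u)
    (hδ : 0 < δ) (hφ : MonotoneOn φ (Ioo 0 δ))
    (hfφ : Tendsto (fun u => f u / φ u) (𝓝[>] 0) (𝓝 1)) {ε : ℝ} (hε : 0 < ε) :
    ∃ r > 0, ∀ u v, 0 < u → u ≤ v → v < r → f u ≤ (1 + ε) * f v := by
  -- This `κ` solves `(1 + κ) / (1 - κ) = 1 + ε`.
  have hκ : 0 < ε / (2 + ε) := by positivity
  have hκ1 : ε / (2 + ε) < 1 := by rw [div_lt_one (by positivity)]; linarith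
  have hκe : 1 + ε / (2 + ε) = (1 + ε) * (1 - ε / (2 + ε)) := by field_simp; ring
  set κ := ε / (2 + ε)
  obtain ⟨r, hr, hrN⟩ := mem_nhdsGT_iff_exists_Ioo_subset.1
    ((hfφ.eventually (gt_mem_nhds (show 1 < 1 + κ by linarith))).and
      (hfφ.eventually (lt_mem_nhds (show 1 - κ < 1 by linarith))))
  have hb : ∀ u, 0 < u → u < r → (1 - κ) * φ u ≤ f u ∧ f u ≤ (1 + κ) * φ u := by
    intro u hu hur
    obtain ⟨h1, h2⟩ := hrN ⟨hu, hur⟩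
    have hφu : 0 < φ u := by
      have : 0 < f u / φ u := by linarith
      by_contra hcon
      exact absurd (div_nonpos_of_nonneg_of_nonpos (hf u hu).le (not_lt.1 hcon)) (not_le.2 this)
    exact ⟨((lt_div_iff₀ hφu).1 h2).le, ((div_lt_iff₀ hφu).1 h1).le⟩
  refine ⟨min r δ, lt_min hr hδ, fun u v hu huv hv => ?_⟩
  have hvr := hv.trans_le (min_le_left _ _)
  have hvδ := hv.trans_le (min_le_right _ _)
  have h1 := (hb u hu (huv.trans_lt hvr)).2
  have h2 := (hb v (hu.trans_le huv) hvr).1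
  have h3 := hφ ⟨hu, huv.trans_lt hvδ⟩ ⟨hu.trans_le huv, hvδ⟩ huv
  calc f u ≤ (1 + κ) * φ u := h1
    _ ≤ (1 + κ) * φ v := by gcongr
    _ = (1 + ε) * ((1 - κ) * φ v) := by rw [hκe]; ring
    _ ≤ (1 + ε) * f v := by gcongr

/-! ### The equation for the rate `Λ` -/

lemma exists_mem_Ioo_add_mul_rpow_eq_one {L γ : ℝ} (hL : 0 < L) (hγ : 0 < γ) :
    ∃ Λ ∈ Ioo (0 : ℝ) 1, Λ + L * Λ ^ γ = 1 := by
  have hc : ContinuousOn (fun Λ : ℝ => Λ + L * Λ ^ γ) (Icc 0 1) :=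
    (continuous_id.add (continuous_const.mul (Real.continuous_rpow_const hγ.le))).continuousOn
  exact intermediate_value_Ioo zero_le_one hc ⟨by simp [Real.zero_rpow hγ.ne'], by simpa using hL⟩

lemma one_sub_mul_rpow_neg_eq_iff {L γ Λ : ℝ} (hΛ : 0 < Λ) :
    (1 - Λ) * Λ ^ (-γ) = L ↔ Λ + L * Λ ^ γ = 1 := by
  rw [Real.rpow_neg hΛ.le, ← div_eq_mul_inv, div_eq_iff (Real.rpow_pos_of_pos hΛ γ).ne']
  constructor <;> intro h <;> linarith

lemma eq_of_add_mul_rpow_eq_one {L γ Λ Λ' : ℝ} (hL : 0 < L) (hγ : 0 < γ) (hΛ : 0 < Λ)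
    (hΛ' : 0 < Λ') (h : Λ + L * Λ ^ γ = 1) (h' : Λ' + L * Λ' ^ γ = 1) : Λ' = Λ := by
  rcases lt_trichotomy Λ' Λ with hlt | heq | hlt
  · have := mul_lt_mul_of_pos_left (Real.rpow_lt_rpow hΛ'.le hlt hγ) hL
    linarith
  · exact heq
  · have := mul_lt_mul_of_pos_left (Real.rpow_lt_rpow hΛ.le hlt hγ) hL
    linarith

/-! ### `F` and its inverse -/

lemma hasStrictDerivAt_F {f : ℝ → ℝ} (hfc : Continuous f) (hf : ∀ u, 0 < u → 0 < f u) {u : ℝ}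
    (hu : 0 < u) : HasStrictDerivAt (F f) (-(1 / f u)) u := by
  have hc : ContinuousOn (fun v => 1 / f v) (Ioi 0) :=
    continuousOn_const.div hfc.continuousOn fun v hv => (hf v hv).ne'
  refine intervalIntegral.integral_hasStrictDerivAt_left
    (ContinuousOn.intervalIntegrable (hc.mono fun v hv => ?_))
    (hc.stronglyMeasurableAtFilter isOpen_Ioi u hu) (hc.continuousAt (Ioi_mem_nhds hu))
  exact (lt_min hu one_pos).trans_le hv.1

lemma strictAntiOn_F {f : ℝ → ℝ} (hfc : Continuous f) (hf : ∀ u, 0 < u → 0 < f u) :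
    StrictAntiOn (F f) (Ioi 0) := by
  refine strictAntiOn_of_deriv_neg (convex_Ioi 0) (fun u hu =>
    (hasStrictDerivAt_F hfc hf hu).hasDerivAt.continuousAt.continuousWithinAt) fun u hu => ?_
  rw [interior_Ioi] at hu
  rw [(hasStrictDerivAt_F hfc hf hu).hasDerivAt.deriv]
  have := hf u hu
  simpa using this

lemma Finv_F {f : ℝ → ℝ} (hfc : Continuous f) (hf : ∀ u, 0 < u → 0 < f u) {u : ℝ} (hu : 0 < u) :
    Finv f (F f u) = u :=
  (strictAntiOn_F hfc hf).injOn.leftInvOn_invFunOn hu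

lemma exists_F_eq {f : ℝ → ℝ} (hfc : Continuous f) (hf : ∀ u, 0 < u → 0 < f u)
    (hF : Tendsto (F f) (𝓝[>] 0) atTop) {t : ℝ} (ht : 0 ≤ t) : t ∈ F f '' Ioi 0 := by
  obtain ⟨u, htu, hu⟩ := ((hF.eventually (eventually_ge_atTop t)).and
    (Ioo_mem_nhdsGT (zero_lt_one' ℝ))).exists
  have hc : ContinuousOn (F f) (Icc u 1) := fun v hv =>
    (hasStrictDerivAt_F hfc hf (hu.1.trans_le hv.1)).hasDerivAt.continuousAt.continuousWithinAt
  have h1 : F f 1 ≤ t := by simpa [F] using ht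
  obtain ⟨v, hv, hvt⟩ := intermediate_value_Icc' hu.2.le hc ⟨h1, htu⟩
  exact ⟨v, hu.1.trans_le hv.1, hvt⟩

lemma F_Finv {f : ℝ → ℝ} (hfc : Continuous f) (hf : ∀ u, 0 < u → 0 < f u)
    (hF : Tendsto (F f) (𝓝[>] 0) atTop) {t : ℝ} (ht : 0 ≤ t) : F f (Finv f t) = t :=
  Function.invFunOn_eq (exists_F_eq hfc hf hF ht)

lemma Finv_pos {f : ℝ → ℝ} (hfc : Continuous f) (hf : ∀ u, 0 < u → 0 < f u)
    (hF : Tendsto (F f) (𝓝[>] 0) atTop) {t : ℝ} (ht : 0 ≤ t) : 0 < Finv f t :=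
  Function.invFunOn_mem (exists_F_eq hfc hf hF ht)

lemma Finv_lt {f : ℝ → ℝ} (hfc : Continuous f) (hf : ∀ u, 0 < u → 0 < f u)
    (hF : Tendsto (F f) (𝓝[>] 0) atTop) {t u : ℝ} (ht : 0 ≤ t) (hu : 0 < u) (h : F f u < t) :
    Finv f t < u :=
  ((strictAntiOn_F hfc hf).lt_iff_gt hu (Finv_pos hfc hf hF ht)).1
    (by rwa [F_Finv hfc hf hF ht])

lemma lt_Finv {f : ℝ → ℝ} (hfc : Continuous f) (hf : ∀ u, 0 < u → 0 < f u)
    (hF : Tendsto (F f) (𝓝[>] 0) atTop) {t u : ℝ} (ht : 0 ≤ t) (hu : 0 < u) (h : t < F f u) :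
    u < Finv f t :=
  ((strictAntiOn_F hfc hf).lt_iff_gt (Finv_pos hfc hf hF ht) hu).1
    (by rwa [F_Finv hfc hf hF ht])

lemma Finv_le_Finv {f : ℝ → ℝ} (hfc : Continuous f) (hf : ∀ u, 0 < u → 0 < f u)
    (hF : Tendsto (F f) (𝓝[>] 0) atTop) {s t : ℝ} (hs : 0 ≤ s) (hst : s ≤ t) :
    Finv f t ≤ Finv f s := by
  have ht := hs.trans hst
  refine ((strictAntiOn_F hfc hf).le_iff_ge (Finv_pos hfc hf hF hs) (Finv_pos hfc hf hF ht)).1 ?_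
  rwa [F_Finv hfc hf hF ht, F_Finv hfc hf hF hs]

lemma tendsto_Finv {f : ℝ → ℝ} (hfc : Continuous f) (hf : ∀ u, 0 < u → 0 < f u)
    (hF : Tendsto (F f) (𝓝[>] 0) atTop) : Tendsto (Finv f) atTop (𝓝[>] 0) := by
  refine tendsto_nhdsWithin_iff.2 ⟨tendsto_order.2 ⟨fun m hm => ?_, fun m hm => ?_⟩, ?_⟩
  · filter_upwards [eventually_ge_atTop 0] with t ht using hm.trans (Finv_pos hfc hf hF ht)
  · filter_upwards [eventually_ge_atTop 0, eventually_gt_atTop (F f m)] with t ht htm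
    exact Finv_lt hfc hf hF ht hm htm
  · filter_upwards [eventually_ge_atTop 0] with t ht using Finv_pos hfc hf hF ht

lemma hasDerivAt_Finv {f : ℝ → ℝ} (hfc : Continuous f) (hf : ∀ u, 0 < u → 0 < f u)
    (hF : Tendsto (F f) (𝓝[>] 0) atTop) {t : ℝ} (ht : 0 ≤ t) :
    HasDerivAt (Finv f) (-f (Finv f t)) t := by
  have hpos := Finv_pos hfc hf hF ht
  have h := (hasStrictDerivAt_F hfc hf hpos).to_local_left_inverse
    (neg_ne_zero.2 (one_div_ne_zero (hf _ hpos).ne')) (g := Finv f)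
    ((eventually_gt_nhds hpos).mono fun u hu => Finv_F hfc hf hu)
  simpa [F_Finv hfc hf hF ht] using h.hasDerivAt

/-! ### Regular variation of `f ∘ F⁻¹` -/

/-- If `f` is regularly varying at `0` with index `β` and asymptotically increasing, then
`f ∘ F⁻¹` is regularly varying at infinity with index `-β / (β - 1)`. -/
lemma tendsto_comp_Finv_div {f : ℝ → ℝ} {β : ℝ} (hfc : Continuous f) (hf : ∀ u, 0 < u → 0 < f u)
    (hF : Tendsto (F f) (𝓝[>] 0) atTop) (hβ : 1 < β)
    (hinc : ∀ ε > 0, ∃ r > 0, ∀ u v, 0 < u → u ≤ v → v < r → f u ≤ (1 + ε) * f v)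
    (hrv : ∀ c : ℝ, 0 < c → Tendsto (fun u => f (c * u) / f u) (𝓝[>] 0) (𝓝 (c ^ β)))
    {l : ℝ} (hl : 0 < l) :
    Tendsto (fun t => f (Finv f (l * t)) / f (Finv f t)) atTop (𝓝 (l ^ (-(β / (β - 1))))) := by
  have hβ0 : 0 < β := by linarith
  have hβ1 : 0 < β - 1 := by linarith
  have hy := tendsto_Finv hfc hf hF
  have hy0 : Tendsto (Finv f) atTop (𝓝 0) := hy.mono_right nhdsWithin_le_nhds
  have hly : Tendsto (fun t => Finv f (l * t)) atTop (𝓝 0) :=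
    hy0.comp (tendsto_id.const_mul_atTop hl)
  -- By L'Hôpital, `F` varies regularly at `0` with index `1 - β`; substitute `u = F⁻¹(t)`.
  have hFrv : ∀ c, 0 < c →
      Tendsto (fun t => F f (c * Finv f t) / t) atTop (𝓝 (c ^ (1 - β))) := by
    intro c hc
    have h : Tendsto (fun u => F f (c * u) / F f u) (𝓝[>] 0) (𝓝 (c ^ (1 - β))) := by
      refine tendsto_div_of_hasDerivAt_of_tendsto_atTop
        (fun u hu => (hasStrictDerivAt_F hfc hf (mul_pos hc hu)).hasDerivAt.comp u
          (hasDerivAt_const_mul c))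
        (fun u hu => (hasStrictDerivAt_F hfc hf hu).hasDerivAt)
        (fun u hu => neg_neg_of_pos (one_div_pos.2 (hf u hu))) hF ?_
      have h2 := ((hrv c hc).inv₀ (Real.rpow_pos_of_pos hc β).ne').const_mul c
      have h3 : c * (c ^ β)⁻¹ = c ^ (1 - β) := by
        rw [Real.rpow_sub hc, Real.rpow_one, div_eq_mul_inv]
      rw [h3] at h2
      refine h2.congr' ?_
      filter_upwards [self_mem_nhdsWithin] with u hu
      have h4 := (hf u hu).ne'
      have h5 := (hf (c * u) (mul_pos hc hu)).ne'
      field_simp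
    refine (h.comp hy).congr' ?_
    filter_upwards [eventually_ge_atTop 0] with t ht
    simp only [Function.comp_apply, F_Finv hfc hf hF ht]
  -- Chosen so that `c ^ (1 - β) = l`: then `F(c F⁻¹(t)) ~ l t`, which suggests `F⁻¹(l t) ~ c
  -- F⁻¹(t)` and the limit `c ^ β`. The proof traps `F⁻¹(l t)` by `d F⁻¹(t)` with `d` on either side
  -- of `c`.
  set c := l ^ (-(1 / (β - 1))) with hc_def
  have hc : 0 < c := Real.rpow_pos_of_pos hl _
  have hcβ : l ^ (-(β / (β - 1))) = c ^ β := by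
    rw [hc_def, ← Real.rpow_mul hl.le]; congr 1; ring
  have hcl : c ^ (1 - β) = l := by
    rw [hc_def, ← Real.rpow_mul hl.le]
    have : -(1 / (β - 1)) * (1 - β) = 1 := by field_simp; ring
    rw [this, Real.rpow_one]
  rw [hcβ]
  have hcont : Continuous fun s : ℝ => s ^ β := Real.continuous_rpow_const hβ0.le
  refine tendsto_order.2 ⟨fun M hM => ?_, fun M hM => ?_⟩
  · obtain ⟨d, ⟨hMd, hd⟩, hdc⟩ : ∃ d, (M < d ^ β ∧ 0 < d) ∧ d < c :=
      ((((hcont.tendsto c).eventually (lt_mem_nhds hM)).and (lt_mem_nhds hc)).filter_mono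
        nhdsWithin_le_nhds |>.and (self_mem_nhdsWithin (s := Iio c))).exists
    obtain ⟨ε, hε', hε⟩ : ∃ ε : ℝ, (1 + ε) * M < d ^ β ∧ 0 < ε := by
      have h : Tendsto (fun ε : ℝ => (1 + ε) * M) (𝓝[>] 0) (𝓝 ((1 + 0) * M)) :=
        (Continuous.tendsto (by fun_prop) 0).mono_left nhdsWithin_le_nhds
      exact ((h.eventually (gt_mem_nhds (by simpa using hMd))).and self_mem_nhdsWithin).exists
    obtain ⟨r, hr, hinc⟩ := hinc ε hε
    have hdl : l < d ^ (1 - β) := by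
      rw [← hcl]; exact Real.rpow_lt_rpow_of_neg hd hdc (by linarith)
    filter_upwards [(hFrv d hd).eventually (lt_mem_nhds hdl),
      ((hrv d hd).comp hy).eventually (lt_mem_nhds hε'), hly.eventually (gt_mem_nhds hr),
      eventually_gt_atTop 0] with t h1 h2 h3 h4
    have hyt := Finv_pos hfc hf hF h4.le
    rw [lt_div_iff₀ h4] at h1
    have h5 := hinc _ _ (mul_pos hd hyt)
      (lt_Finv hfc hf hF (mul_pos hl h4).le (mul_pos hd hyt) h1).le h3
    simp only [Function.comp_apply] at h2
    rw [lt_div_iff₀ (hf _ hyt)] at h2 ⊢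
    refine lt_of_mul_lt_mul_left ?_ (show 0 ≤ 1 + ε by linarith)
    linarith
  · obtain ⟨d, hMd, hcd⟩ : ∃ d, d ^ β < M ∧ c < d :=
      (((hcont.tendsto c).eventually (gt_mem_nhds hM)).filter_mono
        nhdsWithin_le_nhds |>.and (self_mem_nhdsWithin (s := Ioi c))).exists
    have hd : 0 < d := hc.trans hcd
    obtain ⟨ε, hε', hε⟩ : ∃ ε : ℝ, (1 + ε) * d ^ β < M ∧ 0 < ε := by
      have h : Tendsto (fun ε : ℝ => (1 + ε) * d ^ β) (𝓝[>] 0) (𝓝 ((1 + 0) * d ^ β)) :=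
        (Continuous.tendsto (by fun_prop) 0).mono_left nhdsWithin_le_nhds
      exact ((h.eventually (gt_mem_nhds (by simpa using hMd))).and self_mem_nhdsWithin).exists
    obtain ⟨r, hr, hinc⟩ := hinc ε hε
    have hdl : d ^ (1 - β) < l := by
      rw [← hcl]; exact Real.rpow_lt_rpow_of_neg hc hcd (by linarith)
    have hdy : Tendsto (fun t => d * Finv f t) atTop (𝓝 0) := by simpa using hy0.const_mul d
    filter_upwards [(hFrv d hd).eventually (gt_mem_nhds hdl),
      (((hrv d hd).comp hy).const_mul (1 + ε)).eventually (gt_mem_nhds hε'),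
      hdy.eventually (gt_mem_nhds hr), eventually_gt_atTop 0] with t h1 h2 h3 h4
    have hyt := Finv_pos hfc hf hF h4.le
    rw [div_lt_iff₀ h4] at h1
    have h5 := hinc _ _ (Finv_pos hfc hf hF (mul_pos hl h4).le)
      (Finv_lt hfc hf hF (mul_pos hl h4).le (mul_pos hd hyt) h1).le h3
    simp only [Function.comp_apply] at h2
    rw [← mul_div_assoc, div_lt_iff₀ (hf _ hyt)] at h2
    rw [div_lt_iff₀ (hf _ hyt)]
    exact h5.trans_lt h2

/-! ### Solutions: positivity, decay, growth of `F ∘ x` -/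

/-- At a first zero `s` the equation gives `x'(s) = g(s) > 0`, whereas slopes from the left are
nonpositive. -/
lemma IsSolution.pos {f g x : ℝ → ℝ} {ξ : ℝ} (hx : IsSolution f g ξ x) (hξ : 0 < ξ)
    (hf0 : f 0 = 0) (hg : ∀ t, 0 < t → 0 < g t) {t : ℝ} (ht : 0 ≤ t) : 0 < x t := by
  by_contra! hcon
  have hc : ContinuousOn x (Icc 0 t) := hx.continuousOn.mono Icc_subset_Ici_self
  have hx0 : 0 < x 0 := hx.initial ▸ hξ
  set S := {s | s ∈ Icc 0 t ∧ x s ≤ 0} with hS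
  have hSc : IsCompact S := by
    have : S = Icc 0 t ∩ x ⁻¹' Iic 0 := rfl
    rw [this]
    exact isCompact_Icc.of_isClosed_subset
      (hc.preimage_isClosed_of_isClosed isClosed_Icc isClosed_Iic) inter_subset_left
  obtain ⟨s, ⟨hst, hxs⟩, hmin⟩ := hSc.exists_isLeast ⟨t, ⟨ht, le_rfl⟩, hcon⟩
  have hs0 : 0 < s := hst.1.lt_of_ne (by rintro rfl; linarith)
  have hbefore : ∀ r, 0 ≤ r → r < s → 0 < x r := fun r hr hrs => by
    by_contra! h
    exact absurd (hmin ⟨⟨hr, hrs.le.trans hst.2⟩, h⟩) (not_le.2 hrs)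
  have hxs0 : x s = 0 := by
    refine le_antisymm hxs (ge_of_tendsto
      (((hx.hasDerivAt s hs0).continuousAt.tendsto).mono_left (nhdsWithin_le_nhds (s := Iio s))) ?_)
    filter_upwards [Ioo_mem_nhdsLT hs0] with r hr using (hbefore r hr.1.le hr.2).le
  have hd := hx.hasDerivAt s hs0
  rw [hxs0, hf0, neg_zero, zero_add] at hd
  have hslope := (hasDerivAt_iff_tendsto_slope.1 hd).mono_left
    (nhdsWithin_mono s (fun r (hr : r ∈ Iio s) => ne_of_lt hr))
  refine absurd (hg s hs0) (not_lt.2 (le_of_tendsto hslope ?_))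
  filter_upwards [Ioo_mem_nhdsLT hs0] with r hr
  rw [slope_def_field, hxs0]
  exact div_nonpos_of_nonneg_of_nonpos (by linarith [hbefore r hr.1.le hr.2]) (by linarith [hr.2])

/-- If `g` is `O(f ∘ F⁻¹)`, then positive solutions tend to `0`: for a suitable constant `C`, the
function `x + C F⁻¹` is eventually decreasing with derivative at most `-f(x)`. -/
lemma IsSolution.tendsto_zero {f g x : ℝ → ℝ} {ξ L : ℝ} (hx : IsSolution f g ξ x)
    (hfc : Continuous f) (hf : ∀ u, 0 < u → 0 < f u) (hF : Tendsto (F f) (𝓝[>] 0) atTop)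
    (hxpos : ∀ t, 0 ≤ t → 0 < x t)
    (hgL : Tendsto (fun t => g t / f (Finv f t)) atTop (𝓝 L)) : Tendsto x atTop (𝓝 0) := by
  have hy0 : Tendsto (Finv f) atTop (𝓝 0) := (tendsto_Finv hfc hf hF).mono_right nhdsWithin_le_nhds
  set C := |L| + 1 with hC
  have hC0 : 0 ≤ C := by positivity
  have hLC : L < C := by linarith [le_abs_self L]
  obtain ⟨T, hT⟩ := eventually_atTop.1
    ((hgL.eventually (gt_mem_nhds hLC)).and (eventually_gt_atTop 0))
  set w := fun t => x t + C * Finv f t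
  have hwd : ∀ t, T ≤ t → HasDerivAt w (-f (x t) + g t + C * -f (Finv f t)) t := fun t ht =>
    (hx.hasDerivAt t (hT t ht).2).add ((hasDerivAt_Finv hfc hf hF (hT t ht).2.le).const_mul C)
  have hwle : ∀ t, T ≤ t → -f (x t) + g t + C * -f (Finv f t) ≤ -f (x t) := fun t ht => by
    obtain ⟨h1, h2⟩ := hT t ht
    rw [div_lt_iff₀ (hf _ (Finv_pos hfc hf hF h2.le))] at h1
    linarith
  have hwpos : ∀ t, T ≤ t → 0 < w t := fun t ht => by
    have h2 := (hT t ht).2.le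
    have := mul_nonneg hC0 (Finv_pos hfc hf hF h2).le
    linarith [hxpos t h2]
  have hanti : AntitoneOn w (Ici T) := by
    refine antitoneOn_of_hasDerivWithinAt_nonpos
      (f' := fun t => -f (x t) + g t + C * -f (Finv f t)) (convex_Ici T)
      (fun t ht => (hwd t ht).continuousAt.continuousWithinAt) (fun t ht => ?_) (fun t ht => ?_)
    · exact (hwd t (interior_subset ht)).hasDerivWithinAt
    · have ht := interior_subset ht
      linarith [hwle t ht, hf _ (hxpos t (hT t ht).2.le)]
  obtain ⟨l, hl⟩ : ∃ l, Tendsto w atTop (𝓝 l) := by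
    have hmono : Antitone fun t => w (max t T) := fun s t hst =>
      hanti (mem_Ici.2 (le_max_right _ _)) (mem_Ici.2 (le_max_right _ _)) (max_le_max_right T hst)
    refine ⟨_, (tendsto_atTop_ciInf hmono ⟨0, ?_⟩).congr' ?_⟩
    · rintro _ ⟨t, rfl⟩
      exact (hwpos _ (le_max_right _ _)).le
    · filter_upwards [eventually_ge_atTop T] with t ht
      simp only [max_eq_left ht]
  have hxl : Tendsto x atTop (𝓝 l) := by
    have := hl.sub (hy0.const_mul C)
    simpa [w] using this
  have hl0 : 0 ≤ l := ge_of_tendsto hxl <| by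
    filter_upwards [eventually_ge_atTop 0] with t ht using (hxpos t ht).le
  rcases hl0.eq_or_lt with rfl | hlpos
  · exact hxl
  exfalso
  -- If `l > 0`, then eventually `w' ≤ -f(x) < -f(l)/2`, which drives the positive function `w` to a
  -- nonpositive value.
  have hη : 0 < f l / 2 := half_pos (hf l hlpos)
  obtain ⟨T₁, hT₁⟩ := eventually_atTop.1
    ((((hfc.tendsto l).comp hxl).eventually (lt_mem_nhds (half_lt_self (hf l hlpos)))).and
      (eventually_ge_atTop T))
  obtain ⟨t, h1, h2⟩ := ((eventually_nonpos_of_deriv_le hη (fun t ht => hwd t (hT₁ t ht).2)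
    (fun t ht _ => by
      have h3 := (hT₁ t ht).1
      simp only [Function.comp_apply] at h3
      linarith [hwle t (hT₁ t ht).2])).and (eventually_ge_atTop T)).exists
  exact absurd (hwpos t h2) (not_lt.2 h1)

/-- `F ∘ x` grows linearly as soon as `f ∘ F⁻¹` is regularly varying at infinity. -/
lemma IsSolution.tendsto_F_div {f g x : ℝ → ℝ} {ξ L γ Λ : ℝ} (hx : IsSolution f g ξ x)
    (hfc : Continuous f) (hf : ∀ u, 0 < u → 0 < f u) (hF : Tendsto (F f) (𝓝[>] 0) atTop)
    (hinc : ∀ ε > 0, ∃ r > 0, ∀ u v, 0 < u → u ≤ v → v < r → f u ≤ (1 + ε) * f v)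
    (hxpos : ∀ t, 0 ≤ t → 0 < x t) (hx0 : Tendsto x atTop (𝓝 0)) (hL : 0 < L)
    (hgL : Tendsto (fun t => g t / f (Finv f t)) atTop (𝓝 L)) (hγ : 0 < γ)
    (hrv : ∀ c, 0 < c →
      Tendsto (fun t => f (Finv f (c * t)) / f (Finv f t)) atTop (𝓝 (c ^ (-γ))))
    (hΛ : 0 < Λ) (hΛL : Λ + L * Λ ^ γ = 1) :
    Tendsto (fun t => F f (x t) / t) atTop (𝓝 Λ) := by
  refine tendsto_div_of_hasDerivAt_of_regularlyVarying (a := fun t => f (Finv f t))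
    (b := fun t => g t / f (Finv f t)) (z := fun t => F f (x t)) hγ hL hΛ hΛL ?_ ?_ hrv hgL ?_ ?_
  · filter_upwards [eventually_ge_atTop 0] with t ht using hf _ (Finv_pos hfc hf hF ht)
  · intro ε hε
    obtain ⟨r, hr, h⟩ := hinc ε hε
    obtain ⟨T, hT⟩ := eventually_atTop.1
      ((((tendsto_Finv hfc hf hF).mono_right nhdsWithin_le_nhds).eventually (gt_mem_nhds hr)).and
        (eventually_ge_atTop 0))
    refine ⟨T, fun s t hs hst => h _ _ ?_ ?_ (hT s hs).1⟩
    · exact Finv_pos hfc hf hF ((hT s hs).2.trans hst)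
    · exact Finv_le_Finv hfc hf hF (hT s hs).2 hst
  · refine hF.comp (tendsto_nhdsWithin_iff.2 ⟨hx0, ?_⟩)
    filter_upwards [eventually_ge_atTop 0] with t ht using hxpos t ht
  · intro t ht
    have hxt := hxpos t ht.le
    have h1 := (hf _ hxt).ne'
    have h2 := (hf _ (Finv_pos hfc hf hF ht.le)).ne'
    refine ((hasStrictDerivAt_F hfc hf hxt).hasDerivAt.comp t (hx.hasDerivAt t ht)).congr_deriv ?_
    simp only [Finv_F hfc hf hxt]
    field_simp
    ring

end PerturbedODE

theorem mainTheorem3 (f g : ℝ → ℝ) (ξ : ℝ) (x : ℝ → ℝ) (φ : ℝ → ℝ) (δ L : ℝ)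
    (hf_sign : ∀ u, u ≠ 0 → 0 < u * f u) (hf_zero : f 0 = 0)
    (hf_lip : LocallyLipschitz f)
    (hF : Tendsto (PerturbedODE.F f) (𝓝[>] 0) atTop)
    (hg_cont : ContinuousOn g (Ici 0)) (hg_pos : ∀ t, 0 < t → 0 < g t)
    (hξ : 0 < ξ)
    (hx : PerturbedODE.IsSolution f g ξ x)
    (hδ : 0 < δ) (hφ_mono : MonotoneOn φ (Ioo 0 δ))
    (hfφ : Tendsto (fun u => f u / φ u) (𝓝[>] 0) (𝓝 1))
    (hL : 0 < L)
    (hgL : Tendsto (fun t => g t / f (PerturbedODE.Finv f t)) atTop (𝓝 L)) :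
    Tendsto x atTop (𝓝 0) ∧
    (∀ β : ℝ, 1 < β → PerturbedODE.RVZero f β →
      ∃ Λ ∈ Ioo (0 : ℝ) 1,
        (1 - Λ) * Λ ^ (-(β / (β - 1))) = L ∧
        (∀ Λ' : ℝ, 0 < Λ' → (1 - Λ') * Λ' ^ (-(β / (β - 1))) = L → Λ' = Λ) ∧
        Tendsto (fun t => PerturbedODE.F f (x t) / t) atTop (𝓝 Λ)) ∧
    (PerturbedODE.RVInfty (fun t => f (PerturbedODE.Finv f t)) (-1) →
      PerturbedODE.RVInfty (PerturbedODE.Finv f) 0 →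
      ∃ Λ ∈ Ioo (0 : ℝ) 1,
        (1 - Λ) * Λ⁻¹ = L ∧
        (∀ Λ' : ℝ, 0 < Λ' → (1 - Λ') * Λ'⁻¹ = L → Λ' = Λ) ∧
        Λ = 1 / (L + 1) ∧
        Tendsto (fun t => PerturbedODE.F f (x t) / t) atTop (𝓝 Λ)) := by
  have hfc : Continuous f := hf_lip.continuous
  have hf : ∀ u, 0 < u → 0 < f u := fun u hu => pos_of_mul_pos_right (hf_sign u hu.ne') hu.le
  have hinc := fun (ε : ℝ) (hε : ε > 0) =>
    PerturbedODE.le_mul_of_tendsto_div_monotoneOn hf hδ hφ_mono hfφ hε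
  have hxpos := fun (t : ℝ) (ht : 0 ≤ t) => hx.pos hξ hf_zero hg_pos ht
  have hx0 := hx.tendsto_zero hfc hf hF hxpos hgL
  refine ⟨hx0, fun β hβ hrv => ?_, fun hrv _ => ?_⟩
  · have hγ : 0 < β / (β - 1) := div_pos (by linarith) (by linarith)
    obtain ⟨Λ, hΛ, hΛL⟩ := PerturbedODE.exists_mem_Ioo_add_mul_rpow_eq_one hL hγ
    refine ⟨Λ, hΛ, (PerturbedODE.one_sub_mul_rpow_neg_eq_iff hΛ.1).2 hΛL, fun Λ' hΛ' h => ?_, ?_⟩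
    · exact PerturbedODE.eq_of_add_mul_rpow_eq_one hL hγ hΛ.1 hΛ' hΛL
        ((PerturbedODE.one_sub_mul_rpow_neg_eq_iff hΛ').1 h)
    · exact hx.tendsto_F_div hfc hf hF hinc hxpos hx0 hL hgL hγ
        (fun c hc => PerturbedODE.tendsto_comp_Finv_div hfc hf hF hβ hinc hrv.2.2 hc) hΛ.1 hΛL
  · have hpos : 0 < 1 / (L + 1) := by positivity
    refine ⟨1 / (L + 1), ⟨hpos, ?_⟩, ?_, fun Λ' hΛ' h => ?_, rfl, ?_⟩
    · rw [div_lt_one (by positivity)]; linarith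
    · field_simp; ring
    · rw [← div_eq_mul_inv, div_eq_iff hΛ'.ne'] at h
      rw [eq_div_iff (by positivity)]; linarith
    · refine hx.tendsto_F_div hfc hf hF hinc hxpos hx0 hL hgL one_pos hrv.2.2 hpos ?_
      rw [Real.rpow_one]; field_simp; ring
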